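/- **Setting.** All attribute domains are non-empty standard Borel spaces; the language is sorted, i.e. all positions in which a variable occurs have the same attribute domain. A schema consists of finitely many relation symbols, each extensional or intensional, each with finitely many typed attribute positions. A fact $R(c_1,\dots,c_n)$ has $c_i$ in the domain of the $i$-th attribute of $R$; the facts carry the disjoint-union-of-products $\sigma$-algebra. An instance is a finite set of facts; the $\sigma$-algebra on instances is generated by the events "exactly $n$ facts lie in $F$" ($F$ a measurable set of facts, $n\in\mathbb N$). A sub-probabilistic database (sub-PDB) is a sub-probability measure on a space of instances. A parameterized distribution $\psi$ has a parameter space $\Pi_\psi$ that is a product of $m>0$ of the domains, an underlying space $(W_\psi,\mu_\psi)$ that is either countable discrete with counting measure or $\mathbb R^n$ ($n>0$) with Lebesgue measure, and a density $\psi\langle p\rangle\colon W_\psi\to[0,\infty)$, measurable with $\int\psi\langle p\rangle\,d\mu_\psi=1$, for every $p\in\Pi_\psi$. Every $\psi$ in the program is assumed to satisfy the following: for some separable metrizable topology on $\Pi_\psi$ inducing its $\sigma$-algebra, $p\mapsto\psi\langle p\rangle(w)$ is continuous for all $w$, and every $p_0$ has a neighbourhood $N$ with $\int\sup_{p\in N}\psi\langle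 p\rangle\,d\mu_\psi<\infty$. A GDatalog program $\mathcal G$ is a finite bag of rules. A deterministic rule is $R(\bar t)\leftarrow\varphi_b(\bar x)$; a probabilistic rule is $R(\bar u,\psi\langle\bar p\rangle)\leftarrow\varphi_b(\bar x)$, with a single random attribute position, where $W_\psi$ is contained (measurably) in the domain of that position. Here $R$ is intensional, $\varphi_b$ is a finite conjunction of atoms whose terms are variables or constants, and all variables of the rule occur in $\varphi_b$. The existential version $\mathcal G^\exists$ keeps the deterministic rules, and replaces the $i$-th probabilistic rule by the two rules $\exists z\colon R_i(\bar u,\bar p,z)\leftarrow\varphi_b(\bar x)$ and $R(\bar u,z)\leftarrow R_i(\bar u,\bar p,z)$, with a new intensional symbol $R_i$. Let $\mathbb D$ be the space of instances over the extended schema, and $\mathbb D_{\mathsf{in}}\subseteq\mathbb D$ the set of those with extensional facts only. A pair $(\varphi,\bar a)$ is applicable in $D$ if $\varphi\in\mathcal G^\exists$ and there is a valuation of the variables of $\varphi$ that makes the body true and the head false in $D$ and gives the values $\bar a$ to the non-existential positions of the head. $\mathrm{App}(D)$ is the set of applicable pairs. For a sample $b\in W_\varphi$ (where $W_\varphi=W_\psi$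 for an existential rule coming from $\psi$, and $W_\varphi$ is a singleton otherwise) let $\mathrm{ext}(D,\varphi,\bar a,b)=D\cup\{f_\varphi(\bar a,b)\}$, where $f_\varphi(\bar a,b)$ is the head fact with values $\bar a$ and $b$. A measurable chase policy is a measurable function $\mathsf{app}$ defined on $\{D:\mathrm{App}(D)\neq\emptyset\}$ with $\mathsf{app}(D)\in\mathrm{App}(D)$. If $\mathsf{app}(D)=(\varphi,\bar a)$, write $D\vdash D'$ if $D'=\mathrm{ext}(D,\varphi,\bar a,b)$ for some $b\in W_\varphi$, and let $$\vdash^{\mathsf P}(D,E)=\int_{W_\varphi}\mathbf 1[\mathrm{ext}(D,\varphi,\bar a,b)\in E]\;\psi_\varphi\langle\bar a\rangle(b)\;\mu_\varphi(db)$$ (for a non-existential rule, the point mass at the only follow-up instance). If $\mathrm{App}(D)=\emptyset$, then $D\vdash D'$ means $D'=D$, and $\vdash^{\mathsf P}(D,\cdot)=\delta_D$. Let $\mathrm{paths}(\mathsf{app})$ be the set of $(D_0,D_1,\dots)\in\mathbb D^\omega$ with $D_i\vdash D_{i+1}$ for all $i$, and let $\mathrm{paths}(\mathsf{app},D_{\mathsf{in}})$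 be the set of those with $D_0=D_{\mathsf{in}}$. A sequence is terminating if it is eventually constant. The map $\text{lim-inst}_{\mathsf{app}}\colon\mathbb D^\omega\to\mathbb D\uplus\{\bot\}$ sends each terminating path of $\mathsf{app}$ to its final instance and everything else to $\bot$; $\text{lim-inst}_{\mathsf{app},D_{\mathsf{in}}}$ is defined likewise with $\mathrm{paths}(\mathsf{app},D_{\mathsf{in}})$. **Theorem.** Let $\mathcal G$ be a GDatalog program as above and let $\mathsf{app}$ be a measurable chase policy. Then $\vdash^{\mathsf P}$ is a stochastic kernel on $\mathbb D$, and the following hold. 1. For every $D_{\mathsf{in}}\in\mathbb D_{\mathsf{in}}$, the program $\mathcal G$ on input $D_{\mathsf{in}}$ defines a sub-PDB $\mathcal G_{\mathsf{app}}(D_{\mathsf{in}})$ on $\mathbb D$: the map $\text{lim-inst}_{\mathsf{app},D_{\mathsf{in}}}$ is measurable, there is exactly one law $\mathbf P$ on $\mathbb D^\omega$ of a Markov process with initial distribution $\delta_{D_{\mathsf{in}}}$ and transition kernel $\vdash^{\mathsf P}$, and $\mathcal G_{\mathsf{app}}(D_{\mathsf{in}})$ is the restriction to $\mathbb D$ of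 the push-forward of $\mathbf P$ along $\text{lim-inst}_{\mathsf{app},D_{\mathsf{in}}}$. The push-forward gives $\bot$ the mass $\mathbf P(\text{the sequence is not terminating})$. 2. For every sub-PDB $Q$ on $\mathbb D_{\mathsf{in}}$, the program $\mathcal G$ on input $Q$ defines a sub-PDB $\mathcal G_{\mathsf{app}}(Q)$ on $\mathbb D$: the map $\text{lim-inst}_{\mathsf{app}}$ is measurable, there is exactly one measure $\mathbf P$ on $\mathbb D^\omega$, of the same total mass as $Q$, that is the law of a Markov process with initial distribution $Q$ and transition kernel $\vdash^{\mathsf P}$, and $\mathcal G_{\mathsf{app}}(Q)$ is the restriction to $\mathbb D$ of the push-forward of $\mathbf P$ along $\text{lim-inst}_{\mathsf{app}}$. The push-forward gives $\bot$ the mass $\mathbf P(\text{the sequence is not terminating})$. -/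

import Mathlib

open MeasureTheory ProbabilityTheory Set Topology
open scoped ENNReal NNReal

namespace GDatalog

universe u v

/-! ## Schemas, facts, instances

The language is sorted: `dom s` is the attribute domain belonging to the sort `s`, and positions that
are typed equally are positions of the same sort. -/

/-- A finite set of relation symbols, each extensional or intensional; every relation symbol has
finitely many attribute positions, and each position has a sort. -/
structure Schema (S : Type u) where
  Rel : Type
  Attr : Rel → Type
  srt : (R : Rel) → Attr R → S
  IsExt : Rel → Prop
  finite_rel : Finite Rel
  finite_attr : ∀ R, Finite (Attr R)

/-- A fact `R(c₁, …, cₙ)`. The σ-algebra on facts is the disjoint union, over the relation symbols,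
of the product σ-algebras. -/
abbrev Fact {S : Type u} (σ : Schema S) (dom : S → Type v) : Type v :=
  Σ R : σ.Rel, ∀ i : σ.Attr R, dom (σ.srt R i)

/-- A database instance under set semantics: a finite set of facts. -/
def Inst {S : Type u} (σ : Schema S) (dom : S → Type v) : Type v :=
  {D : Set (Fact σ dom) // D.Finite}

namespace Inst

variable {S : Type u} {σ : Schema S} {dom : S → Type v}

/-- The set of facts of an instance. -/
def facts (D : Inst σ dom) : Set (Fact σ dom) := D.1

/-- `D ∪ {f}`. -/
def add (D : Inst σ dom) (f : Fact σ dom) : Inst σ dom := ⟨insert f D.1, D.2.insert f⟩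

variable [∀ s, MeasurableSpace (dom s)]

/-- The instances that contain exactly `n` facts from `F`. -/
def countingEvent (F : Set (Fact σ dom)) (n : ℕ) : Set (Inst σ dom) :=
  {D | (D.facts ∩ F).ncard = n}

/-- The σ-algebra generated by the counting events of measurable sets of facts. -/
instance : MeasurableSpace (Inst σ dom) :=
  MeasurableSpace.generateFrom
    {C | ∃ F : Set (Fact σ dom), MeasurableSet F ∧ ∃ n : ℕ, C = countingEvent F n}

end Inst

/-- A sub-probabilistic database with instance space `Ω`: a sub-probability measure on `Ω`. -/
def SubPDB (Ω : Type v) [MeasurableSpace Ω] : Type v := {P : Measure Ω // P univ ≤ 1}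

/-! ## Parameterized distributions -/

/-- The two kinds of underlying spaces of parameterized distributions: countable discrete spaces with
the counting measure, and `ℝⁿ`, `n > 0`, with Lebesgue measure. -/
inductive BaseSpace : Type 1
  | discrete (W : Type) (countable : Countable W) : BaseSpace
  | euclidean (n : ℕ) (pos : 0 < n) : BaseSpace

namespace BaseSpace

/-- The set of points. -/
abbrev Carrier : BaseSpace → Type
  | discrete W _ => W
  | euclidean n _ => Fin n → ℝ

/-- The power set in the discrete case, the Borel sets in the Euclidean case. -/
instance measurableSpace : (B : BaseSpace) → MeasurableSpace B.Carrier
  | discrete _ _ => ⊤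
  | euclidean n _ => inferInstanceAs (MeasurableSpace (Fin n → ℝ))

/-- Counting measure, respectively Lebesgue measure. -/
noncomputable def measure : (B : BaseSpace) → Measure B.Carrier
  | discrete W _ => @Measure.count W ⊤
  | euclidean n _ => (volume : Measure (Fin n → ℝ))

end BaseSpace

/-- A parameterized distribution `ψ`, whose parameter space is the product of `m > 0` attribute
domains. In the Euclidean case, almost everywhere measurability with respect to Lebesgue measure says
that `ψ⟨p⟩` is measurable with respect to the Lebesgue measurable sets. -/
structure ParamDist {S : Type u} (dom : S → Type v) where
  m : ℕ
  m_pos : 0 < m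
  psort : Fin m → S
  base : BaseSpace
  density : (∀ j, dom (psort j)) → base.Carrier → ℝ≥0
  aemeasurable_density : ∀ p, AEMeasurable (density p) base.measure
  lintegral_density : ∀ p, ∫⁻ w, (density p w : ℝ≥0∞) ∂base.measure = 1

/-- The parameter space `Π_ψ`. -/
abbrev ParamDist.Param {S : Type u} {dom : S → Type v} (ψ : ParamDist dom) : Type v :=
  ∀ j, dom (ψ.psort j)

/-- The technical conditions on a parameterized distribution: for some separable metrizable topology
on the parameter space, whose Borel sets are the measurable sets (so that a standard Borel parameter
space is a Borel subset of a Polish space), `p ↦ ψ⟨p⟩(w)` is continuous for every `w`, and every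
parameter has a neighbourhood `N` such that `sup_{p ∈ N} ψ⟨p⟩` has finite integral. -/
def ParamDist.IsRegular {S : Type u} {dom : S → Type v} [∀ s, MeasurableSpace (dom s)]
    (ψ : ParamDist dom) : Prop :=
  ∃ (_ : TopologicalSpace ψ.Param),
    SecondCountableTopology ψ.Param ∧ TopologicalSpace.MetrizableSpace ψ.Param ∧
      BorelSpace ψ.Param ∧
    (∀ w, Continuous fun p => ψ.density p w) ∧
    ∀ p₀, ∃ N ∈ 𝓝 p₀, ∫⁻ w, ⨆ p ∈ N, (ψ.density p w : ℝ≥0∞) ∂ψ.base.measure < ∞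

/-! ## Rules and programs -/

/-- Deterministic terms of a given sort over variables `x : X` of sorts `vs x`. -/
inductive Term {S : Type u} (dom : S → Type v) {X : Type} (vs : X → S) : S → Type (max u v)
  | var (x : X) : Term dom vs (vs x)
  | const {s : S} (c : dom s) : Term dom vs s

namespace Term

variable {S : Type u} {dom : S → Type v} {X : Type} {vs : X → S}

/-- The value of a term under a valuation. -/
def eval (α : ∀ x, dom (vs x)) : {s : S} → Term dom vs s → dom s
  | _, var x => α x
  | _, const c => c

/-- The variables of a term. -/
def vars : {s : S} → Term dom vs s → Set X
  | _, var x => {x}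
  | _, const _ => ∅

/-- Transport along an equality of sorts. -/
def cast {s t : S} (h : s = t) (x : Term dom vs s) : Term dom vs t := h ▸ x

/-- The same term, with one further variable (of sort `t`) available. -/
def weaken (t : S) : {s : S} → Term dom vs s → Term dom (Sum.elim vs fun _ : Unit => t) s
  | _, var x => var (vs := Sum.elim vs fun _ : Unit => t) (Sum.inl x)
  | _, const c => const c

end Term

/-- A deterministic atom. -/
structure Atom {S : Type u} (σ : Schema S) (dom : S → Type v) {X : Type} (vs : X → S) where
  rel : σ.Rel
  args : ∀ i : σ.Attr rel, Term dom vs (σ.srt rel i)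

/-- The fact obtained from an atom by a valuation. -/
def Atom.ground {S : Type u} {σ : Schema S} {dom : S → Type v} {X : Type} {vs : X → S}
    (A : Atom σ dom vs) (α : ∀ x, dom (vs x)) : Fact σ dom :=
  ⟨A.rel, fun i => (A.args i).eval α⟩

/-- The body of a rule: a list of deterministic atoms over finitely many sorted variables, each of
which occurs in the body. -/
structure Body {S : Type u} (σ : Schema S) (dom : S → Type v) where
  nvar : ℕ
  vs : Fin nvar → S
  atoms : List (Atom σ dom vs)
  occurs : ∀ x : Fin nvar, ∃ A ∈ atoms, ∃ i, x ∈ (A.args i).vars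

/-- A deterministic rule `R(t₁, …, tₙ) ← body`. Its variables are those of the body. -/
structure DetRule {S : Type u} (σ : Schema S) (dom : S → Type v) where
  body : Body σ dom
  head : Atom σ dom body.vs
  intensional : ¬ σ.IsExt head.rel

/-- A probabilistic rule `R(u, ψ⟨p⟩) ← body`, where the `ψ`-term stands in the attribute position
`pos`, and `u` are the deterministic terms in the other positions. The map `incl` is the inclusion of
the underlying space of `ψ` in the domain of the attribute `pos`. -/
structure ProbRule {S : Type u} (σ : Schema S) (dom : S → Type v)
    [∀ s, MeasurableSpace (dom s)] where
  body : Body σ dom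
  rel : σ.Rel
  intensional : ¬ σ.IsExt rel
  pos : σ.Attr rel
  args : ∀ i : {i : σ.Attr rel // i ≠ pos}, Term dom body.vs (σ.srt rel i)
  dist : ParamDist dom
  params : ∀ j : Fin dist.m, Term dom body.vs (dist.psort j)
  incl : dist.base.Carrier → dom (σ.srt rel pos)
  incl_injective : Function.Injective incl
  incl_measurable : Measurable incl

/-- A GDatalog program: a finite bag of rules, given as a finite family of deterministic rules and a
finite family of probabilistic rules. -/
structure Program {S : Type u} (σ : Schema S) (dom : S → Type v)
    [∀ s, MeasurableSpace (dom s)] where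
  nDet : ℕ
  nProb : ℕ
  det : Fin nDet → DetRule σ dom
  prob : Fin nProb → ProbRule σ dom

/-! ## The associated existential Datalog program -/

/-- A Datalog rule whose head may have an existentially quantified variable: if `ex = some i`, it
stands in position `i` of the head; if `ex = none`, the rule is an ordinary Datalog rule. -/
structure ExRule {S : Type u} (σ : Schema S) (dom : S → Type v) where
  Var : Type
  vs : Var → S
  body : List (Atom σ dom vs)
  rel : σ.Rel
  ex : Option (σ.Attr rel)
  args : ∀ i : {i : σ.Attr rel // ¬ ex = some i}, Term dom vs (σ.srt rel i)

namespace ExRule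

variable {S : Type u} {σ : Schema S} {dom : S → Type v}

/-- The space `V_φ` of valuations of the variables of the rule. -/
abbrev Valuation (φ : ExRule σ dom) : Type v := ∀ x, dom (φ.vs x)

/-- The ground space `V_φ⁽ʰ⁾`: values for all head positions but the existential one. -/
abbrev HeadGround (φ : ExRule σ dom) : Type v :=
  ∀ i : {i : σ.Attr φ.rel // ¬ φ.ex = some i}, dom (σ.srt φ.rel i)

/-- Values for the existentially quantified variable, if there is one (otherwise a singleton). -/
abbrev Witness (φ : ExRule σ dom) : Type v :=
  ∀ i : {i : σ.Attr φ.rel // φ.ex = some i}, dom (σ.srt φ.rel i)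

/-- The map `π_φ` from valuations to head groundings. -/
def proj (φ : ExRule σ dom) (α : φ.Valuation) : φ.HeadGround := fun i => (φ.args i).eval α

open Classical in
/-- The fact obtained from the head by substituting the head grounding and the witness. -/
noncomputable def headFact (φ : ExRule σ dom) (a : φ.HeadGround) (c : φ.Witness) : Fact σ dom :=
  ⟨φ.rel, fun i => if h : φ.ex = some i then c ⟨i, h⟩ else a ⟨i, h⟩⟩

/-- `D ⊨ φ_b(α)` and `D ⊭ φ_h(α)`. -/
def ApplicableFor (φ : ExRule σ dom) (D : Inst σ dom) (α : φ.Valuation) : Prop :=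
  (¬ ∃ c, φ.headFact (φ.proj α) c ∈ D.facts) ∧ ∀ A ∈ φ.body, A.ground α ∈ D.facts

end ExRule

namespace Program

variable {S : Type u} {σ : Schema S} {dom : S → Type v} [∀ s, MeasurableSpace (dom s)]

/-- The schema of the existential version: a new intensional relation symbol `R_j` is added for every
probabilistic rule `R(u, ψ⟨p⟩) ← body`. Its positions are those of `u`, those of `p`, and one for the
sampled value. -/
abbrev exSchema (G : Program σ dom) : Schema S where
  Rel := σ.Rel ⊕ Fin G.nProb
  Attr
    | Sum.inl R => σ.Attr R
    | Sum.inr j =>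
        {i : σ.Attr (G.prob j).rel // i ≠ (G.prob j).pos} ⊕ (Fin (G.prob j).dist.m ⊕ Unit)
  srt
    | Sum.inl R => σ.srt R
    | Sum.inr j => Sum.elim (fun i => σ.srt (G.prob j).rel i)
        (Sum.elim (G.prob j).dist.psort fun _ => σ.srt (G.prob j).rel (G.prob j).pos)
  IsExt := Sum.elim σ.IsExt fun _ => False
  finite_rel := by
    have := σ.finite_rel
    infer_instance
  finite_attr := by
    have := σ.finite_attr
    rintro (R | j)
    · exact this R
    · have := this (G.prob j).rel
      infer_instance

/-- An atom over the original schema, as an atom over the schema of the existential version. -/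
abbrev liftAtom (G : Program σ dom) {X : Type} {vs : X → S} (A : Atom σ dom vs) :
    Atom G.exSchema dom vs where
  rel := Sum.inl A.rel
  args := A.args

/-- The rules of the existential version: the deterministic rules, and two rules for each
probabilistic rule. -/
inductive RuleIdx (G : Program σ dom) : Type
  | det (i : Fin G.nDet) : RuleIdx G
  | sample (j : Fin G.nProb) : RuleIdx G
  | copy (j : Fin G.nProb) : RuleIdx G

/-- A deterministic rule of the program, over the schema of the existential version. -/
abbrev detRule (G : Program σ dom) (i : Fin G.nDet) : ExRule G.exSchema dom where
  Var := Fin (G.det i).body.nvar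
  vs := (G.det i).body.vs
  body := (G.det i).body.atoms.map G.liftAtom
  rel := Sum.inl (G.det i).head.rel
  ex := none
  args := fun k => (G.det i).head.args k.1

/-- The rule `∃ z : R_j(u, p, z) ← body`. -/
abbrev sampleRule (G : Program σ dom) (j : Fin G.nProb) : ExRule G.exSchema dom where
  Var := Fin (G.prob j).body.nvar
  vs := (G.prob j).body.vs
  body := (G.prob j).body.atoms.map G.liftAtom
  rel := Sum.inr j
  ex := some (Sum.inr (Sum.inr ()))
  args
    | ⟨Sum.inl i, _⟩ => (G.prob j).args i
    | ⟨Sum.inr (Sum.inl k), _⟩ => (G.prob j).params k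
    | ⟨Sum.inr (Sum.inr ()), h⟩ => absurd rfl h

open Classical in
/-- The rule `R(u, z) ← R_j(u, p, z)`. -/
noncomputable abbrev copyRule (G : Program σ dom) (j : Fin G.nProb) : ExRule G.exSchema dom where
  Var := Fin (G.prob j).body.nvar ⊕ Unit
  vs := Sum.elim (G.prob j).body.vs fun _ => σ.srt (G.prob j).rel (G.prob j).pos
  body :=
    [{ rel := Sum.inr j
       args := fun
        | Sum.inl i => ((G.prob j).args i).weaken _
        | Sum.inr (Sum.inl k) => ((G.prob j).params k).weaken _
        | Sum.inr (Sum.inr ()) => Term.var (vs := Sum.elim (G.prob j).body.vs fun _ : Unit =>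
            σ.srt (G.prob j).rel (G.prob j).pos) (Sum.inr ()) }]
  rel := Sum.inl (G.prob j).rel
  ex := none
  args := fun k =>
    let i : σ.Attr (G.prob j).rel := k.1
    show Term dom (Sum.elim (G.prob j).body.vs fun _ : Unit =>
        σ.srt (G.prob j).rel (G.prob j).pos) (σ.srt (G.prob j).rel i) from
      if h : i = (G.prob j).pos then
        (Term.var (vs := Sum.elim (G.prob j).body.vs fun _ : Unit =>
          σ.srt (G.prob j).rel (G.prob j).pos) (Sum.inr ())).cast (congrArg (σ.srt _) h.symm)
      else ((G.prob j).args ⟨i, h⟩).weaken _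

/-- The existential version of the program. -/
noncomputable abbrev exRule (G : Program σ dom) : RuleIdx G → ExRule G.exSchema dom
  | .det i => G.detRule i
  | .sample j => G.sampleRule j
  | .copy j => G.copyRule j

/-- The space `𝔻` of instances over the schema of the existential version. -/
abbrev DD (G : Program σ dom) : Type v := Inst G.exSchema dom

/-- The input instances: all of their facts are extensional. -/
def inputs (G : Program σ dom) : Set G.DD := {D | ∀ f ∈ D.facts, G.exSchema.IsExt f.1}

/-- The space of pairs `(φ, a)` of a rule and a head grounding, with the disjoint union σ-algebra. -/
abbrev AA (G : Program σ dom) : Type v := Σ φ : RuleIdx G, (G.exRule φ).HeadGround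

/-- The set of applicable pairs. -/
def App (G : Program σ dom) (D : G.DD) : Set G.AA :=
  {p | ∃ α : (G.exRule p.1).Valuation,
    (G.exRule p.1).ApplicableFor D α ∧ (G.exRule p.1).proj α = p.2}

/-! ## Chase steps -/

/-- The sample space `W_φ`; a singleton if `φ` is not existential. -/
abbrev Sample (G : Program σ dom) : RuleIdx G → Type
  | .det _ => Unit
  | .sample j => (G.prob j).dist.base.Carrier
  | .copy _ => Unit

instance sampleMeasurableSpace (G : Program σ dom) :
    (φ : RuleIdx G) → MeasurableSpace (G.Sample φ)
  | .det _ => inferInstanceAs (MeasurableSpace Unit)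
  | .sample j => inferInstanceAs (MeasurableSpace (G.prob j).dist.base.Carrier)
  | .copy _ => inferInstanceAs (MeasurableSpace Unit)

/-- The measure `μ_φ` on the sample space. -/
noncomputable def sampleMeasure (G : Program σ dom) : (φ : RuleIdx G) → Measure (G.Sample φ)
  | .det _ => Measure.dirac ()
  | .sample j => (G.prob j).dist.base.measure
  | .copy _ => Measure.dirac ()

/-- The density `ψ_φ⟨a⟩`, which depends only on the parameter part of the head grounding `a`; it is
constantly `1` if `φ` is not existential. -/
def sampleDensity (G : Program σ dom) :
    (φ : RuleIdx G) → (G.exRule φ).HeadGround → G.Sample φ → ℝ≥0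
  | .det _, _, _ => 1
  | .sample j, a, b =>
      (G.prob j).dist.density (fun k => a ⟨Sum.inr (Sum.inl k), fun h => by cases h⟩) b
  | .copy _, _, _ => 1

/-- A sample outcome, as a value for the existential position of the head. -/
def sampleWitness (G : Program σ dom) :
    (φ : RuleIdx G) → G.Sample φ → (G.exRule φ).Witness
  | .det _, _ => fun i => absurd i.2 (Option.some_ne_none _).symm
  | .sample j, b => fun
      | ⟨Sum.inl _, h⟩ => by cases h
      | ⟨Sum.inr (Sum.inl _), h⟩ => by cases h
      | ⟨Sum.inr (Sum.inr ()), _⟩ => (G.prob j).incl b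
  | .copy _, _ => fun i => absurd i.2 (Option.some_ne_none _).symm

/-- `ext(D, φ, a, b) = D ∪ {f_φ(a, b)}`. -/
noncomputable def ext (G : Program σ dom) (D : G.DD) (p : G.AA) (b : G.Sample p.1) : G.DD :=
  D.add ((G.exRule p.1).headFact p.2 (G.sampleWitness p.1 b))

/-- The set of follow-up instances of `D` with respect to `(φ, a)`. -/
def followUps (G : Program σ dom) (D : G.DD) (p : G.AA) : Set G.DD := range (G.ext D p)

/-- The probability `μ(E)` of a set `E` of instances in the chase step that starts in `D` and uses
`(φ, a)`: the integral of `ξ(D, φ, a, ·, E) · ψ_φ⟨a⟩` with respect to `μ_φ`. -/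
noncomputable def fireProb (G : Program σ dom) (D : G.DD) (p : G.AA) (E : Set G.DD) : ℝ≥0∞ :=
  ∫⁻ b, {b | G.ext D p b ∈ E}.indicator 1 b * (G.sampleDensity p.1 p.2 b : ℝ≥0∞)
    ∂G.sampleMeasure p.1

/-- A measurable chase policy. -/
structure ChasePolicy (G : Program σ dom) where
  app : {D : G.DD // (G.App D).Nonempty} → G.AA
  app_mem : ∀ D, app D ∈ G.App D.1
  measurable_app : Measurable app

end Program

namespace Program.ChasePolicy

variable {S : Type u} {σ : Schema S} {dom : S → Type v} [∀ s, MeasurableSpace (dom s)]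
  {G : Program σ dom} (π : G.ChasePolicy)

open Classical in
/-- The relation `D ⊢ D'`. -/
def StepE (D D' : G.DD) : Prop :=
  if h : (G.App D).Nonempty then D' ∈ G.followUps D (π.app ⟨D, h⟩) else D' = D

open Classical in
/-- The transition probabilities `⊢ᴾ(D, E)` of the chase. -/
noncomputable def stepP (D : G.DD) (E : Set G.DD) : ℝ≥0∞ :=
  if h : (G.App D).Nonempty then
    G.fireProb D (π.app ⟨D, h⟩) (E ∩ G.followUps D (π.app ⟨D, h⟩))
  else E.indicator 1 D

/-- The paths of the chase policy. -/
def paths : Set (ℕ → G.DD) := {ω | ∀ i, π.StepE (ω i) (ω (i + 1))}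

/-- The paths of the chase policy that start in `D₀`. -/
def pathsFrom (D₀ : G.DD) : Set (ℕ → G.DD) := {ω | ω ∈ π.paths ∧ ω 0 = D₀}

/-- `P` is the law, on the path space, of a Markov process with state space `𝔻`, initial distribution
`μ₀` and transition probabilities `⊢ᴾ`. -/
def IsChaseLaw (μ₀ : Measure G.DD) (P : Measure (ℕ → G.DD)) : Prop :=
  P.map (fun ω => ω 0) = μ₀ ∧
  ∀ (n : ℕ) (A : Set (Fin (n + 1) → G.DD)) (E : Set G.DD), MeasurableSet A → MeasurableSet E →
    P {ω | (fun i : Fin (n + 1) => ω i) ∈ A ∧ ω (n + 1) ∈ E} =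
      ∫⁻ ω in {ω | (fun i : Fin (n + 1) => ω i) ∈ A}, π.stepP (ω n) E ∂P

end Program.ChasePolicy

section Limit

variable {Ω : Type v}

/-- The path is eventually constant. -/
def IsTerminating (ω : ℕ → Ω) : Prop := ∃ i, ∀ j > i, ω j = ω i

open Classical in
/-- The map that sends a terminating path in `T` to its final entry, and every other path to the error
event `⊥`, which is the second summand of `Ω ⊕ Unit`. -/
noncomputable def limInst (T : Set (ℕ → Ω)) (ω : ℕ → Ω) : Ω ⊕ Unit :=
  if h : ω ∈ T ∧ IsTerminating ω then Sum.inl (ω h.2.choose) else Sum.inr ()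

end Limit

/-- The chase with policy `π` from the initial distribution `μ₀` defines an output sub-probabilistic
database by means of the limit map `lim`: this map is measurable; there is exactly one path measure
`P` of the chase (of the same mass as `μ₀`); its push-forward along `lim` gives `⊥` the probability of
the non-terminating paths, and is, on `𝔻`, a (unique) sub-probabilistic database. -/
def Program.ChasePolicy.DefinesOutput {S : Type u} {σ : Schema S} {dom : S → Type v}
    [∀ s, MeasurableSpace (dom s)] {G : Program σ dom} (π : G.ChasePolicy)
    (μ₀ : Measure G.DD) (lim : (ℕ → G.DD) → G.DD ⊕ Unit) : Prop :=
  Measurable lim ∧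
  ∃ P : Measure (ℕ → G.DD),
    π.IsChaseLaw μ₀ P ∧ (∀ P', π.IsChaseLaw μ₀ P' → P' = P) ∧
    P univ = μ₀ univ ∧
    P.map lim {Sum.inr ()} = P {ω | ¬ IsTerminating ω} ∧
    ∃! Δ : SubPDB G.DD, ∀ E, MeasurableSet E → Δ.1 E = P.map lim (Sum.inl '' E)

end GDatalog

/-!
# Generative Datalog with continuous distributions: the chase defines a sub-probabilistic database

The state space of the chase is the space of finite sets of facts, with the σ-algebra generated by
the counting events. The central observation is `Inst.measurableSet_exists_mem`: the map that sends an
instance to the counting measure on its facts is a kernel (`Inst.factKernel`), with finite values, so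
quantification over the facts of an instance preserves measurability. No selection theorem is needed,
and all measurability questions about rules become questions about facts:

* Applicability (`ExRule.measurableSet_exists_applicableFor`): every variable of a rule that matters
  occurs in the body, so an applicable valuation can be read off from finitely many facts of the
  instance, and the quantifier over valuations becomes a quantifier over facts.
* Equality of instances and the map `D, f ↦ D ∪ {f}` are measurable (`Inst.instMeasurableEq`,
  `Inst.measurable_add`).
* The relation "`D'` is a follow-up instance of `D`" is measurable (`Program.measurableSet_followUps`):
  the new fact is one of the facts of `D'`, and its sampled value lies in the range of an injective
  measurable map between standard Borel spaces.

The transition probabilities are integrals of densities, which depend measurably on the instance once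
the densities are jointly measurable in the parameter and the sample. This holds by a Carathéodory
argument (`ParamDist.IsRegular.exists_measurable_density`): the densities are continuous in the
parameter and measurable in the sample, up to a single null set.

The transition probabilities thus form a Markov kernel. The law of the chase exists by the theorem of
Ionescu-Tulcea, and is unique since it is determined by its finite-dimensional marginals
(`exists_isMarkovLaw`, `IsMarkovLaw.unique`). Neither requires topological assumptions on the space of
instances. The measurable set of paths has full measure under this law (`ae_mem_paths`), and the limit
map is measurable because the diagonal of the space of instances is (`measurable_limInst`); the output
is the restriction of the push-forward of the law along the limit map.
-/

namespace GDatalog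

universe u v

/-! ### Measurability on disjoint unions -/

section Proj

variable {ι : Type*} {α : ι → Type*} [∀ i, Nonempty (α i)]

open Classical in
/-- The component of a point of a disjoint union at the index `i`; an arbitrary value if the point
lies in another summand. -/
noncomputable def sigmaProj (i : ι) (p : Sigma α) : α i :=
  if h : p.1 = i then h ▸ p.2 else Classical.arbitrary _

@[simp]
lemma sigmaProj_mk (i : ι) (a : α i) : sigmaProj i (⟨i, a⟩ : Sigma α) = a := by
  simp [sigmaProj]

lemma sigma_mk_sigmaProj {i : ι} {p : Sigma α} (h : p.1 = i) : ⟨i, sigmaProj i p⟩ = p := by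
  obtain ⟨j, a⟩ := p
  subst h
  simp

end Proj

section Sigma

variable {ι : Type*} {α : ι → Type*} [∀ i, MeasurableSpace (α i)]

lemma measurableSet_sigma_iff {s : Set (Sigma α)} :
    MeasurableSet s ↔ ∀ i, MeasurableSet (Sigma.mk i ⁻¹' s) := by
  simp only [MeasurableSpace.measurableSet_iInf]
  rfl

lemma measurable_sigma_mk (i : ι) : Measurable (Sigma.mk i : α i → Sigma α) :=
  fun _ hs => measurableSet_sigma_iff.1 hs i

lemma measurableSet_sigma_fst (i : ι) : MeasurableSet {p : Sigma α | p.1 = i} := by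
  refine measurableSet_sigma_iff.2 fun j => ?_
  by_cases h : j = i <;> simp [h]

variable [∀ i, Nonempty (α i)]

lemma measurable_sigmaProj (i : ι) : Measurable (sigmaProj i : Sigma α → α i) := by
  intro s hs
  refine measurableSet_sigma_iff.2 fun j => ?_
  by_cases h : j = i
  · subst h
    simpa [preimage_preimage] using hs
  · simp only [preimage_preimage, sigmaProj, h, dite_false]
    exact measurable_const hs

lemma measurableSet_prod_sigma [Countable ι] {X : Type*} [MeasurableSpace X]
    {s : Set (X × Sigma α)}
    (h : ∀ i, MeasurableSet {q : X × α i | (q.1, (⟨i, q.2⟩ : Sigma α)) ∈ s}) :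
    MeasurableSet s := by
  have hs : s = ⋃ i, {q | q.2.1 = i} ∩
      (fun q : X × Sigma α => (q.1, sigmaProj i q.2)) ⁻¹'
        {q : X × α i | (q.1, (⟨i, q.2⟩ : Sigma α)) ∈ s} := by
    ext ⟨x, j, a⟩
    simp
  rw [hs]
  exact .iUnion fun i => (measurable_snd (measurableSet_sigma_fst i)).inter
    ((measurable_fst.prodMk ((measurable_sigmaProj i).comp measurable_snd)) (h i))

lemma measurable_prod_sigma [Countable ι] {X Y : Type*} [MeasurableSpace X] [MeasurableSpace Y]
    {f : X × Sigma α → Y} (h : ∀ i, Measurable fun q : X × α i => f (q.1, ⟨i, q.2⟩)) :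
    Measurable f :=
  fun _ hs => measurableSet_prod_sigma fun i => h i hs

instance Sigma.instMeasurableEq [Countable ι] [∀ i, MeasurableEq (α i)] :
    MeasurableEq (Sigma α) := by
  constructor
  have hd : diagonal (Sigma α) = ⋃ i, {q | q.1.1 = i} ∩ {q | q.2.1 = i} ∩
      {q | sigmaProj i q.1 = sigmaProj i q.2} := by
    ext ⟨p, q⟩
    simp only [mem_diagonal_iff, mem_iUnion, mem_inter_iff, mem_ofPred_eq]
    constructor
    · rintro rfl
      exact ⟨p.1, ⟨rfl, rfl⟩, rfl⟩
    · rintro ⟨i, ⟨h₁, h₂⟩, h⟩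
      rw [← sigma_mk_sigmaProj h₁, ← sigma_mk_sigmaProj h₂, h]
  rw [hd]
  exact .iUnion fun i => ((measurable_fst (measurableSet_sigma_fst i)).inter
    (measurable_snd (measurableSet_sigma_fst i))).inter
    (measurableSet_eq_fun ((measurable_sigmaProj i).comp measurable_fst)
      ((measurable_sigmaProj i).comp measurable_snd))

end Sigma

lemma _root_.StandardBorelSpace.measurableEq (α : Type*) [MeasurableSpace α]
    [StandardBorelSpace α] : MeasurableEq α := by
  let _ := upgradeStandardBorel α
  exact ⟨isClosed_diagonal.measurableSet⟩

instance Schema.instFiniteRel {S : Type u} (σ : Schema S) : Finite σ.Rel := σ.finite_rel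

instance Schema.instFiniteAttr {S : Type u} (σ : Schema S) (R : σ.Rel) : Finite (σ.Attr R) :=
  σ.finite_attr R

/-! ### The measurable space of instances -/

namespace Inst

variable {S : Type u} {σ : Schema S} {dom : S → Type v} [∀ s, MeasurableSpace (dom s)]

lemma measurable_ncard {F : Set (Fact σ dom)} (hF : MeasurableSet F) :
    Measurable fun D : Inst σ dom => (D.facts ∩ F).ncard :=
  measurable_to_countable' fun n => MeasurableSpace.measurableSet_generateFrom ⟨F, hF, n, rfl⟩

lemma measurable_of_ncard {X : Type*} [MeasurableSpace X] {D : X → Inst σ dom}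
    (h : ∀ F, MeasurableSet F → Measurable fun x => ((D x).facts ∩ F).ncard) : Measurable D := by
  refine measurable_generateFrom ?_
  rintro _ ⟨F, hF, n, rfl⟩
  exact h F hF (measurableSet_singleton n)

variable [∀ s, StandardBorelSpace (dom s)] [∀ s, Nonempty (dom s)]

instance instMeasurableEqFact : MeasurableEq (Fact σ dom) := by
  have h (R : σ.Rel) : MeasurableEq (∀ i : σ.Attr R, dom (σ.srt R i)) :=
    StandardBorelSpace.measurableEq _
  infer_instance

/-- The counting measure on the facts of an instance, as a kernel. The σ-algebra on instances is
generated by the values of this kernel on measurable sets. -/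
noncomputable def factKernel : Kernel (Inst σ dom) (Fact σ dom) where
  toFun D := Measure.count.restrict D.facts
  measurable' := by
    refine Measure.measurable_of_measurable_coe _ fun F hF => ?_
    have h (D : Inst σ dom) :
        Measure.count.restrict D.facts F = ((D.facts ∩ F).ncard : ℝ≥0∞) := by
      have hfin : (D.facts ∩ F).Finite := D.2.inter_of_left F
      rw [Measure.restrict_apply hF, inter_comm,
        Measure.count_apply_finite' hfin (D.2.measurableSet.inter hF), ncard_eq_toFinset_card _ hfin]
    simp_rw [h]
    exact (measurable_from_top (f := fun n : ℕ => (n : ℝ≥0∞))).comp (measurable_ncard hF)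

lemma factKernel_apply (D : Inst σ dom) : factKernel D = Measure.count.restrict D.facts := rfl

/-- Measurable conditions remain measurable under quantification over the facts of an instance. -/
lemma measurableSet_exists_mem {X : Type*} [MeasurableSpace X] {D : X → Inst σ dom}
    (hD : Measurable D) {M : Set (X × Fact σ dom)} (hM : MeasurableSet M) :
    MeasurableSet {x | ∃ f ∈ (D x).facts, (x, f) ∈ M} := by
  have hfin (x : X) : IsFiniteMeasure ((factKernel.comap D hD) x) := by
    rw [Kernel.comap_apply, factKernel_apply, isFiniteMeasure_restrict]
    exact (Measure.count_apply_lt_top.2 (D x).2).ne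
  have hmeas := Kernel.measurable_kernel_prodMk_left_of_finite hM hfin
  -- Some fact satisfies the condition if and only if the number of such facts is not zero.
  convert (hmeas (measurableSet_singleton 0)).compl using 1
  ext x
  have hx : MeasurableSet (Prod.mk x ⁻¹' M) := measurable_prodMk_left hM
  simp only [mem_ofPred_eq, mem_compl_iff, mem_preimage, mem_singleton_iff, Kernel.comap_apply,
    factKernel_apply, Measure.restrict_apply hx, Measure.count_eq_zero_iff, ← ne_eq,
    ← nonempty_iff_ne_empty]
  exact ⟨fun ⟨f, h₁, h₂⟩ => ⟨f, h₂, h₁⟩, fun ⟨f, h₂, h₁⟩ => ⟨f, h₁, h₂⟩⟩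

lemma measurableSet_mem {X : Type*} [MeasurableSpace X] {D : X → Inst σ dom} (hD : Measurable D)
    {f : X → Fact σ dom} (hf : Measurable f) : MeasurableSet {x | f x ∈ (D x).facts} := by
  convert measurableSet_exists_mem hD
    (measurableSet_eq_fun (hf.comp measurable_fst) measurable_snd) using 1
  ext x
  simp

lemma measurableSet_exists_fin_mem (n : ℕ) {X : Type v} [MeasurableSpace X]
    {D : X → Inst σ dom} (hD : Measurable D) {M : Set (X × (Fin n → Fact σ dom))}
    (hM : MeasurableSet M) :
    MeasurableSet {x | ∃ f : Fin n → Fact σ dom, (∀ k, f k ∈ (D x).facts) ∧ (x, f) ∈ M} := by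
  induction n generalizing X with
  | zero =>
    convert (measurable_prodMk_right (y := Fin.elim0) : Measurable fun x : X => (x, _)) hM using 1
    ext x
    simp only [mem_ofPred_eq, mem_preimage, IsEmpty.forall_iff, true_and]
    constructor
    · rintro ⟨f, hf⟩
      rwa [Subsingleton.elim f Fin.elim0] at hf
    · exact fun h => ⟨_, h⟩
  | succ n ih =>
    have hcons : Measurable fun q : (X × Fact σ dom) × (Fin n → Fact σ dom) =>
        (q.1.1, (Fin.cons q.1.2 q.2 : Fin (n + 1) → Fact σ dom)) := by
      refine (measurable_fst.comp measurable_fst).prodMk (measurable_pi_lambda _ fun k => ?_)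
      refine Fin.cases ?_ (fun k => ?_) k
      · exact measurable_snd.comp measurable_fst
      · exact (measurable_pi_apply k).comp measurable_snd
    convert measurableSet_exists_mem hD (ih (hD.comp measurable_fst) (hcons hM)) using 1
    ext x
    constructor
    · rintro ⟨f, hf, hfM⟩
      refine ⟨f 0, hf 0, Fin.tail f, fun k => hf k.succ, ?_⟩
      rw [mem_preimage, Fin.cons_self_tail]
      exact hfM
    · rintro ⟨f₀, hf₀, f, hf, hfM⟩
      exact ⟨Fin.cons f₀ f, fun k => Fin.cases hf₀ hf k, hfM⟩

lemma measurableSet_exists_pi_mem {κ : Type*} [Finite κ] {X : Type v} [MeasurableSpace X]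
    {D : X → Inst σ dom} (hD : Measurable D) {M : Set (X × (κ → Fact σ dom))}
    (hM : MeasurableSet M) :
    MeasurableSet {x | ∃ f : κ → Fact σ dom, (∀ k, f k ∈ (D x).facts) ∧ (x, f) ∈ M} := by
  obtain ⟨n, ⟨e⟩⟩ := Finite.exists_equiv_fin κ
  have he : Measurable fun q : X × (Fin n → Fact σ dom) => (q.1, fun k => q.2 (e k)) :=
    measurable_fst.prodMk
      (measurable_pi_lambda _ fun k => (measurable_pi_apply (e k)).comp measurable_snd)
  convert measurableSet_exists_fin_mem n hD (he hM) using 1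
  ext x
  constructor
  · rintro ⟨f, hf, hfM⟩
    exact ⟨fun k => f (e.symm k), fun k => hf _, by simpa using hfM⟩
  · rintro ⟨f, hf, hfM⟩
    exact ⟨fun k => f (e k), fun k => hf _, hfM⟩

lemma measurable_add {X : Type*} [MeasurableSpace X] {D : X → Inst σ dom} (hD : Measurable D)
    {f : X → Fact σ dom} (hf : Measurable f) : Measurable fun x => (D x).add (f x) := by
  classical
  refine measurable_of_ncard fun F hF => ?_
  have h (x : X) : (((D x).add (f x)).facts ∩ F).ncard =
      ((D x).facts ∩ F).ncard + if f x ∈ F ∧ f x ∉ (D x).facts then 1 else 0 := by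
    have hadd : ((D x).add (f x)).facts = insert (f x) (D x).facts := rfl
    have hfin : ((D x).facts ∩ F).Finite := (D x).2.inter_of_left F
    rw [hadd]
    split_ifs with hx
    · rw [insert_inter_of_mem hx.1, ncard_insert_of_notMem (fun h => hx.2 h.1) hfin]
    · by_cases hF' : f x ∈ F
      · rw [insert_eq_of_mem (by_contra fun h => hx ⟨hF', h⟩), add_zero]
      · rw [insert_inter_of_notMem hF', add_zero]
  simp_rw [h]
  exact ((measurable_ncard hF).comp hD).add
    (Measurable.ite ((hf hF).inter (measurableSet_mem hD hf).compl) measurable_const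
      measurable_const)

instance instMeasurableEq : MeasurableEq (Inst σ dom) := by
  constructor
  have hsub {X : Type v} [MeasurableSpace X] {D D' : X → Inst σ dom} (hD : Measurable D)
      (hD' : Measurable D') : MeasurableSet {x | (D x).facts ⊆ (D' x).facts} := by
    convert (measurableSet_exists_mem hD
      (measurableSet_mem (hD'.comp measurable_fst) measurable_snd).compl).compl using 1
    ext x
    simp only [mem_ofPred_eq, mem_compl_iff, not_exists, not_and, not_not]
    rfl
  convert (hsub measurable_fst measurable_snd).inter (hsub measurable_snd measurable_fst) using 1
  ext ⟨D, D'⟩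
  simp only [mem_diagonal_iff, mem_inter_iff, mem_ofPred_eq, ← Subset.antisymm_iff]
  exact Subtype.ext_iff

end Inst

/-! ### Applicability of a rule -/

section Ground

variable {S : Type u} {σ : Schema S} {dom : S → Type v} {X : Type} {vs : X → S}

lemma Term.eval_congr {s : S} (t : Term dom vs s) {α β : ∀ x, dom (vs x)}
    (h : ∀ x ∈ t.vars, α x = β x) : t.eval α = t.eval β := by
  cases t with
  | var x => exact h x rfl
  | const c => rfl

variable [∀ s, MeasurableSpace (dom s)]

lemma Term.measurable_eval {s : S} (t : Term dom vs s) :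
    Measurable fun α : ∀ x, dom (vs x) => t.eval α := by
  cases t with
  | var x => exact measurable_pi_apply x
  | const c => exact measurable_const

lemma Term.exists_read {s : S} (t : Term dom vs s) {x : X} (hx : x ∈ t.vars) :
    ∃ g : dom s → dom (vs x), Measurable g ∧ ∀ α : ∀ x, dom (vs x), g (t.eval α) = α x := by
  cases t with
  | var y =>
    obtain rfl : x = y := hx
    exact ⟨id, measurable_id, fun _ => rfl⟩
  | const c => exact hx.elim

lemma Atom.measurable_ground (A : Atom σ dom vs) :
    Measurable fun α : ∀ x, dom (vs x) => A.ground α :=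
  (measurable_sigma_mk A.rel).comp (measurable_pi_lambda _ fun i => (A.args i).measurable_eval)

end Ground

namespace ExRule

variable {S : Type u} {σ : Schema S} {dom : S → Type v} (φ : ExRule σ dom)

/-- The variables that occur in the body. -/
def bodyVars : Set φ.Var := {x | ∃ A ∈ φ.body, ∃ i, x ∈ (A.args i).vars}

/-- Every variable of the head, the existential one excepted, occurs in the body. Variables that
occur nowhere in the rule are permitted: the rule that copies a sampled fact does not mention the
variables of the original body that are absent from the head. -/
def IsSafe : Prop := ∀ i, (φ.args i).vars ⊆ φ.bodyVars

variable {φ} in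
lemma ApplicableFor.congr (hφ : φ.IsSafe) {D : Inst σ dom} {α β : φ.Valuation}
    (h : ∀ x ∈ φ.bodyVars, α x = β x) (hα : φ.ApplicableFor D α) : φ.ApplicableFor D β := by
  have hproj : φ.proj α = φ.proj β :=
    funext fun i => (φ.args i).eval_congr fun x hx => h x (hφ i hx)
  refine ⟨hproj ▸ hα.1, fun A hA => ?_⟩
  have hground : A.ground α = A.ground β := by
    unfold Atom.ground
    congr 1
    exact funext fun i => (A.args i).eval_congr fun x hx => h x ⟨A, hA, i, hx⟩
  exact hground ▸ hα.2 A hA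

section Nonempty

variable [∀ s, Nonempty (dom s)]

/-- The value of a fact in the existential position of the head, provided that the fact belongs to
the head relation. -/
noncomputable def witnessOf (f : Fact σ dom) : φ.Witness := fun i => sigmaProj φ.rel f i.1

lemma witnessOf_headFact (a : φ.HeadGround) (c : φ.Witness) :
    φ.witnessOf (φ.headFact a c) = c := by
  funext i
  simp [witnessOf, headFact, i.2]

end Nonempty

variable [∀ s, MeasurableSpace (dom s)]

lemma measurable_proj : Measurable φ.proj :=
  measurable_pi_lambda _ fun i => (φ.args i).measurable_eval

lemma measurable_headFact :
    Measurable fun q : φ.HeadGround × φ.Witness => φ.headFact q.1 q.2 := by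
  refine (measurable_sigma_mk φ.rel).comp (measurable_pi_lambda _ fun i => ?_)
  by_cases h : φ.ex = some i
  · simp only [h, dite_true]
    exact (measurable_pi_apply _).comp measurable_snd
  · simp only [h, dite_false]
    exact (measurable_pi_apply _).comp measurable_fst

variable [∀ s, Nonempty (dom s)]

lemma measurable_witnessOf : Measurable φ.witnessOf :=
  measurable_pi_lambda _ fun i => (measurable_pi_apply i.1).comp (measurable_sigmaProj φ.rel)

variable [∀ s, StandardBorelSpace (dom s)]

lemma measurableSet_applicableFor :
    MeasurableSet {q : Inst σ dom × φ.Valuation | φ.ApplicableFor q.1 q.2} := by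
  have hhead : MeasurableSet {q : (Inst σ dom × φ.Valuation) × Fact σ dom |
      φ.headFact (φ.proj q.1.2) (φ.witnessOf q.2) = q.2} :=
    measurableSet_eq_fun (φ.measurable_headFact.comp
      ((φ.measurable_proj.comp (measurable_snd.comp measurable_fst)).prodMk
        (φ.measurable_witnessOf.comp measurable_snd))) measurable_snd
  have hbody : MeasurableSet {q : Inst σ dom × φ.Valuation |
      ∀ A ∈ φ.body, A.ground q.2 ∈ q.1.facts} := by
    have h : {q : Inst σ dom × φ.Valuation | ∀ A ∈ φ.body, A.ground q.2 ∈ q.1.facts} =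
        ⋂ A ∈ {A | A ∈ φ.body}, {q | A.ground q.2 ∈ q.1.facts} := by
      ext q
      simp
    rw [h]
    exact .biInter (List.finite_toSet _).countable fun A _ =>
      Inst.measurableSet_mem measurable_fst (A.measurable_ground.comp measurable_snd)
  convert (Inst.measurableSet_exists_mem measurable_fst hhead).compl.inter hbody using 1
  ext q
  refine and_congr_left fun _ => not_congr ⟨?_, ?_⟩
  · rintro ⟨c, hc⟩
    exact ⟨_, hc, by simp [witnessOf_headFact]⟩
  · rintro ⟨f, hf, hfq⟩
    exact ⟨φ.witnessOf f, by rwa [show φ.headFact _ _ = f from hfq]⟩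

/-- Applicability of a safe rule is a measurable event. A variable of the body is read off from one
of the facts of the instance, so that the quantifier over the uncountably many valuations may be
replaced by quantifiers over the facts of the instance. -/
lemma measurableSet_exists_applicableFor [Finite φ.Var] (hφ : φ.IsSafe) :
    MeasurableSet {D : Inst σ dom | ∃ α, φ.ApplicableFor D α} := by
  classical
  have hread (x : φ.bodyVars) : ∃ r : Fact σ dom → dom (φ.vs x), Measurable r ∧
      ∃ A ∈ φ.body, ∀ α, r (A.ground α) = α x := by
    obtain ⟨A, hA, i, hx⟩ := x.2
    obtain ⟨g, hg, hgα⟩ := (A.args i).exists_read hx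
    refine ⟨fun f => g (sigmaProj A.rel f i),
      hg.comp ((measurable_pi_apply i).comp (measurable_sigmaProj A.rel)), A, hA, fun α => ?_⟩
    simp [Atom.ground, hgα]
  choose r hr A hA hrA using hread
  let val (f : φ.bodyVars → Fact σ dom) : φ.Valuation := fun x =>
    if h : x ∈ φ.bodyVars then r ⟨x, h⟩ (f ⟨x, h⟩) else Classical.arbitrary _
  have hval : Measurable val := by
    refine measurable_pi_lambda _ fun x => ?_
    by_cases h : x ∈ φ.bodyVars
    · simp only [val, h, dite_true]
      exact (hr ⟨x, h⟩).comp (measurable_pi_apply _)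
    · simp only [val, h, dite_false]
      exact measurable_const
  convert Inst.measurableSet_exists_pi_mem measurable_id
    ((measurable_fst.prodMk (hval.comp measurable_snd)) φ.measurableSet_applicableFor) using 1
  ext D
  constructor
  · rintro ⟨α, hα⟩
    refine ⟨fun x => (A x).ground α, fun x => hα.2 _ (hA x), hα.congr hφ fun x hx => ?_⟩
    simp [val, hx, hrA]
  · rintro ⟨f, -, hf⟩
    exact ⟨_, hf⟩

end ExRule

/-! ### Joint measurability of densities -/

instance BaseSpace.instSFiniteMeasure : (B : BaseSpace) → SFinite B.measure
  | discrete W h => by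
    let _ : MeasurableSpace W := ⊤
    exact inferInstanceAs (SFinite (Measure.count : Measure W))
  | euclidean n _ => inferInstanceAs (SFinite (volume : Measure (Fin n → ℝ)))

instance BaseSpace.instStandardBorelSpace : (B : BaseSpace) → StandardBorelSpace B.Carrier
  | discrete W h => by
    let _ : MeasurableSpace W := ⊤
    have : DiscreteMeasurableSpace W := ⟨fun _ => trivial⟩
    exact inferInstanceAs (StandardBorelSpace W)
  | euclidean n _ => inferInstanceAs (StandardBorelSpace (Fin n → ℝ))

/-- Outside a single null set, the density at every parameter is a limit of measurable functions,
namely of versions of the densities at the parameters in a countable dense set. After modification on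
this null set the density is continuous in the parameter and measurable in the sample, hence jointly
measurable. -/
lemma ParamDist.IsRegular.exists_measurable_density {S : Type u} {dom : S → Type v}
    [∀ s, MeasurableSpace (dom s)] {ψ : ParamDist dom} (hψ : ψ.IsRegular) :
    ∃ g : ψ.Param × ψ.base.Carrier → ℝ≥0, Measurable g ∧
      ∀ p, (fun w => g (p, w)) =ᵐ[ψ.base.measure] ψ.density p := by
  classical
  obtain ⟨τ, h2, hm, hb, hcont, -⟩ := hψ
  obtain ⟨d, hd, hdense⟩ := TopologicalSpace.exists_countable_dense ψ.Param
  have hver (p : ψ.Param) : ψ.density p =ᵐ[ψ.base.measure] (ψ.aemeasurable_density p).mk :=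
    (ψ.aemeasurable_density p).ae_eq_mk
  have hae : ∀ᵐ w ∂ψ.base.measure, ∀ p ∈ d, ψ.density p w = (ψ.aemeasurable_density p).mk _ w :=
    (ae_ball_iff hd).2 fun p _ => hver p
  obtain ⟨N, hsub, hN, hN0⟩ := exists_measurable_superset_of_null (ae_iff.1 hae)
  let g (p : ψ.Param) (w : ψ.base.Carrier) : ℝ≥0 := if w ∈ N then 0 else ψ.density p w
  have hgcont (w : ψ.base.Carrier) : Continuous fun p => g p w := by
    by_cases hw : w ∈ N
    · simpa only [g, hw, if_true] using continuous_const
    · simpa only [g, hw, if_false] using hcont w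
  have hgd (p : ψ.Param) (hp : p ∈ d) : Measurable (g p) := by
    have h : g p = fun w => if w ∈ N then 0 else (ψ.aemeasurable_density p).mk _ w := by
      funext w
      by_cases hw : w ∈ N
      · simp only [g, hw, if_true]
      · simp only [g, hw, if_false]
        exact by_contra fun hne => hw (hsub fun hall => hne (hall p hp))
    rw [h]
    exact Measurable.ite hN measurable_const (ψ.aemeasurable_density p).measurable_mk
  have hgmeas (p : ψ.Param) : Measurable (g p) := by
    obtain ⟨q, hq, hqp⟩ := mem_closure_iff_seq_limit.1 (hdense p)
    exact measurable_of_tendsto_metrizable (fun n => hgd (q n) (hq n))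
      (tendsto_pi_nhds.2 fun w => ((hgcont w).tendsto p).comp hqp)
  refine ⟨Function.uncurry g, measurable_uncurry_of_continuous_of_measurable hgcont hgmeas,
    fun p => ?_⟩
  filter_upwards [measure_eq_zero_iff_ae_notMem.1 hN0] with w hw
  simp [Function.uncurry, g, hw]

/-! ### The rules of the existential version -/

section Term

variable {S : Type u} {dom : S → Type v} {X : Type} {vs : X → S}

lemma Term.vars_cast {s t : S} (h : s = t) (x : Term dom vs s) : (x.cast h).vars = x.vars := by
  subst h
  rfl

end Term

namespace Program

variable {S : Type u} {σ : Schema S} {dom : S → Type v} [∀ s, MeasurableSpace (dom s)]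
  (G : Program σ dom)

instance instFiniteRuleIdx : Finite (RuleIdx G) := by
  let e : RuleIdx G → Fin G.nDet ⊕ Fin G.nProb ⊕ Fin G.nProb
    | .det i => .inl i
    | .sample j => .inr (.inl j)
    | .copy j => .inr (.inr j)
  refine Finite.of_injective e ?_
  rintro (i | i | i) (j | j | j) h <;> simp_all [e]

instance instFiniteVar : (φ : RuleIdx G) → Finite (G.exRule φ).Var
  | .det i => inferInstanceAs (Finite (Fin (G.det i).body.nvar))
  | .sample j => inferInstanceAs (Finite (Fin (G.prob j).body.nvar))
  | .copy j => inferInstanceAs (Finite (Fin (G.prob j).body.nvar ⊕ Unit))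

lemma isSafe_exRule : (φ : RuleIdx G) → (G.exRule φ).IsSafe
  | .det i => fun _ x _ => by
    obtain ⟨A, hA, k, hx⟩ := (G.det i).body.occurs x
    exact ⟨G.liftAtom A, List.mem_map_of_mem hA, k, hx⟩
  | .sample j => fun _ x _ => by
    obtain ⟨A, hA, k, hx⟩ := (G.prob j).body.occurs x
    exact ⟨G.liftAtom A, List.mem_map_of_mem hA, k, hx⟩
  | .copy j => fun k x hx => by
    refine ⟨_, List.mem_singleton_self _, ?_⟩
    obtain ⟨i, hi⟩ := k
    change σ.Attr (G.prob j).rel at i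
    by_cases h : i = (G.prob j).pos
    · refine ⟨Sum.inr (Sum.inr ()), ?_⟩
      simp only [h, dite_true] at hx
      exact (Term.vars_cast _ _).subset hx
    · refine ⟨Sum.inl ⟨i, h⟩, ?_⟩
      simpa [h] using hx

section Applicable

variable [∀ s, StandardBorelSpace (dom s)] [∀ s, Nonempty (dom s)]

lemma measurableSet_app_nonempty : MeasurableSet {D : G.DD | (G.App D).Nonempty} := by
  have h : {D : G.DD | (G.App D).Nonempty} =
      ⋃ φ, {D | ∃ α, (G.exRule φ).ApplicableFor D α} := by
    ext D
    simp only [mem_ofPred_eq, mem_iUnion]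
    constructor
    · rintro ⟨⟨φ, a⟩, α, hα, -⟩
      exact ⟨φ, α, hα⟩
    · rintro ⟨φ, α, hα⟩
      exact ⟨⟨φ, (G.exRule φ).proj α⟩, α, hα, rfl⟩
  rw [h]
  exact .iUnion fun φ => (G.exRule φ).measurableSet_exists_applicableFor (G.isSafe_exRule φ)

end Applicable

/-! ### Firing a rule -/

instance instSFiniteSampleMeasure : (φ : RuleIdx G) → SFinite (G.sampleMeasure φ)
  | .det _ => inferInstanceAs (SFinite (Measure.dirac ()))
  | .sample j => inferInstanceAs (SFinite (G.prob j).dist.base.measure)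
  | .copy _ => inferInstanceAs (SFinite (Measure.dirac ()))

instance instStandardBorelSpaceSample : (φ : RuleIdx G) → StandardBorelSpace (G.Sample φ)
  | .det _ => inferInstanceAs (StandardBorelSpace Unit)
  | .sample j => inferInstanceAs (StandardBorelSpace (G.prob j).dist.base.Carrier)
  | .copy _ => inferInstanceAs (StandardBorelSpace Unit)

lemma measurable_sampleWitness : (φ : RuleIdx G) → Measurable (G.sampleWitness φ)
  | .det _ => measurable_pi_lambda _ fun i => absurd i.2 (Option.some_ne_none _).symm
  | .sample j => measurable_pi_lambda _ fun
    | ⟨Sum.inl _, h⟩ => by cases h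
    | ⟨Sum.inr (Sum.inl _), h⟩ => by cases h
    | ⟨Sum.inr (Sum.inr ()), _⟩ => (G.prob j).incl_measurable
  | .copy _ => measurable_pi_lambda _ fun i => absurd i.2 (Option.some_ne_none _).symm

lemma sampleWitness_injective : (φ : RuleIdx G) → Function.Injective (G.sampleWitness φ)
  | .det _ => fun _ _ _ => rfl
  | .sample j => fun _ _ h =>
    (G.prob j).incl_injective (congrFun h ⟨Sum.inr (Sum.inr ()), rfl⟩)
  | .copy _ => fun _ _ _ => rfl

lemma lintegral_sampleDensity (φ : RuleIdx G) (a : (G.exRule φ).HeadGround) :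
    ∫⁻ b, (G.sampleDensity φ a b : ℝ≥0∞) ∂G.sampleMeasure φ = 1 := by
  cases φ with
  | det i => simp [sampleDensity, sampleMeasure]
  | sample j => exact (G.prob j).dist.lintegral_density _
  | copy j => simp [sampleDensity, sampleMeasure]

lemma fireProb_inter_followUps (D : G.DD) (p : G.AA) (E : Set G.DD) :
    G.fireProb D p (E ∩ G.followUps D p) = G.fireProb D p E := by
  simp [fireProb, followUps]

lemma exists_measurable_sampleDensity (hG : ∀ j, (G.prob j).dist.IsRegular) (φ : RuleIdx G) :
    ∃ g : (G.exRule φ).HeadGround × G.Sample φ → ℝ≥0, Measurable g ∧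
      ∀ a, (fun b => g (a, b)) =ᵐ[G.sampleMeasure φ] G.sampleDensity φ a := by
  cases φ with
  | det i => exact ⟨fun _ => 1, measurable_const, fun a => .rfl⟩
  | sample j =>
    obtain ⟨g, hg, hae⟩ := (hG j).exists_measurable_density
    refine ⟨fun q => g (fun k => q.1 ⟨Sum.inr (Sum.inl k), fun h => by cases h⟩, q.2),
      hg.comp (Measurable.prodMk (measurable_pi_lambda _ fun k => ?_) measurable_snd),
      fun a => hae fun k => a ⟨Sum.inr (Sum.inl k), fun h => by cases h⟩⟩
    exact (measurable_pi_apply _).comp measurable_fst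
  | copy j => exact ⟨fun _ => 1, measurable_const, fun a => .rfl⟩

variable [∀ s, StandardBorelSpace (dom s)]

lemma measurableSet_range_sampleWitness (φ : RuleIdx G) :
    MeasurableSet (range (G.sampleWitness φ)) :=
  ((G.measurable_sampleWitness φ).measurableEmbedding
    (G.sampleWitness_injective φ)).measurableSet_range

variable [∀ s, Nonempty (dom s)]

lemma measurable_ext {X : Type*} [MeasurableSpace X] (φ : RuleIdx G) {D : X → G.DD}
    (hD : Measurable D) {a : X → (G.exRule φ).HeadGround} (ha : Measurable a)
    {b : X → G.Sample φ} (hb : Measurable b) :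
    Measurable fun x => G.ext (D x) ⟨φ, a x⟩ (b x) :=
  Inst.measurable_add hD ((G.exRule φ).measurable_headFact.comp
    (ha.prodMk ((G.measurable_sampleWitness φ).comp hb)))

/-- The distribution of the follow-up instance when a rule is fired. -/
noncomputable def fireMeasure (D : G.DD) (p : G.AA) : Measure G.DD :=
  ((G.sampleMeasure p.1).withDensity fun b => G.sampleDensity p.1 p.2 b).map (G.ext D p)

lemma fireMeasure_apply (D : G.DD) (p : G.AA) {E : Set G.DD} (hE : MeasurableSet E) :
    G.fireMeasure D p E = G.fireProb D p E := by
  have hext : Measurable (G.ext D p) :=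
    G.measurable_ext p.1 measurable_const measurable_const measurable_id
  rw [fireMeasure, Measure.map_apply hext hE, withDensity_apply _ (hext hE),
    ← lintegral_indicator (hext hE), fireProb]
  refine lintegral_congr fun b => ?_
  by_cases hb : G.ext D p b ∈ E <;> simp [hb]

instance instIsProbabilityMeasureFireMeasure (D : G.DD) (p : G.AA) :
    IsProbabilityMeasure (G.fireMeasure D p) := by
  constructor
  rw [fireMeasure_apply _ _ _ .univ, fireProb]
  simpa using G.lintegral_sampleDensity p.1 p.2

lemma measurable_fireProb (hG : ∀ j, (G.prob j).dist.IsRegular) {E : Set G.DD}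
    (hE : MeasurableSet E) : Measurable fun q : G.DD × G.AA => G.fireProb q.1 q.2 E := by
  refine measurable_prod_sigma fun φ => ?_
  obtain ⟨g, hg, hae⟩ := G.exists_measurable_sampleDensity hG φ
  have heq (q : G.DD × (G.exRule φ).HeadGround) : G.fireProb q.1 ⟨φ, q.2⟩ E =
      ∫⁻ b, {r : (G.DD × (G.exRule φ).HeadGround) × G.Sample φ |
        G.ext r.1.1 ⟨φ, r.1.2⟩ r.2 ∈ E}.indicator (fun r => (g (r.1.2, r.2) : ℝ≥0∞)) (q, b)
        ∂G.sampleMeasure φ := by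
    refine lintegral_congr_ae ?_
    filter_upwards [hae q.2] with b hb
    by_cases hbE : G.ext q.1 ⟨φ, q.2⟩ b ∈ E <;> simp [hbE, hb]
  simp_rw [heq]
  refine Measurable.lintegral_prod_right' (Measurable.indicator ?_ ?_)
  · exact (hg.comp ((measurable_snd.comp measurable_fst).prodMk measurable_snd)).coe_nnreal_ennreal
  · exact G.measurable_ext φ (measurable_fst.comp measurable_fst)
      (measurable_snd.comp measurable_fst) measurable_snd hE

/-- The follow-up relation is measurable. A follow-up instance `D'` contains the fact that was added,
so the sample is recovered from one of the finitely many facts of `D'`; that it lies in the underlying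
space of the distribution is a measurable condition by the Lusin–Souslin theorem. -/
lemma measurableSet_followUps :
    MeasurableSet {q : (G.DD × G.DD) × G.AA | q.1.2 ∈ G.followUps q.1.1 q.2} := by
  refine measurableSet_prod_sigma fun φ => ?_
  have hM : MeasurableSet {r : ((G.DD × G.DD) × (G.exRule φ).HeadGround) × Fact G.exSchema dom |
      (G.exRule φ).headFact r.1.2 ((G.exRule φ).witnessOf r.2) = r.2 ∧
      (G.exRule φ).witnessOf r.2 ∈ range (G.sampleWitness φ) ∧ r.1.1.1.add r.2 = r.1.1.2} := by
    have hw : Measurable fun r : ((G.DD × G.DD) × (G.exRule φ).HeadGround) × Fact G.exSchema dom =>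
        (G.exRule φ).witnessOf r.2 := (G.exRule φ).measurable_witnessOf.comp measurable_snd
    have heq : MeasurableEq (Fact G.exSchema dom) := Inst.instMeasurableEqFact
    refine MeasurableSet.inter ?_ (MeasurableSet.inter ?_ ?_)
    · exact measurableSet_eq_fun ((G.exRule φ).measurable_headFact.comp
        ((measurable_snd.comp measurable_fst).prodMk hw)) measurable_snd
    · exact hw (G.measurableSet_range_sampleWitness φ)
    · exact measurableSet_eq_fun (Inst.measurable_add
        (measurable_fst.comp (measurable_fst.comp measurable_fst)) measurable_snd)
        (measurable_snd.comp (measurable_fst.comp measurable_fst))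
  convert Inst.measurableSet_exists_mem (measurable_snd.comp measurable_fst) hM using 1
  ext ⟨⟨D, D'⟩, a⟩
  constructor
  · rintro ⟨b, hb⟩
    have hb' : G.ext D ⟨φ, a⟩ b = D' := hb
    refine ⟨(G.exRule φ).headFact a (G.sampleWitness φ b), ?_, ?_⟩
    · have hmem : (G.exRule φ).headFact a (G.sampleWitness φ b) ∈ (G.ext D ⟨φ, a⟩ b).facts :=
        mem_insert _ _
      exact hb' ▸ hmem
    · have hw := (G.exRule φ).witnessOf_headFact a (G.sampleWitness φ b)
      exact ⟨congrArg _ hw, ⟨b, hw.symm⟩, hb'⟩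
  · rintro ⟨f, -, hf, ⟨b, hb⟩, hadd⟩
    refine ⟨b, ?_⟩
    rw [← hb] at hf
    change D.add ((G.exRule φ).headFact a (G.sampleWitness φ b)) = D'
    exact hf ▸ hadd

namespace ChasePolicy

variable {G} (π : G.ChasePolicy)

/-! ### The transition kernel of the chase -/

lemma measurable_stepP (hG : ∀ j, (G.prob j).dist.IsRegular) {E : Set G.DD}
    (hE : MeasurableSet E) : Measurable fun D => π.stepP D E := by
  classical
  have hstep : (fun D => π.stepP D E) = fun D => if h : D ∈ {D : G.DD | (G.App D).Nonempty} then
      G.fireProb D (π.app ⟨D, h⟩) E else E.indicator 1 D := by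
    funext D
    simp only [stepP, G.fireProb_inter_followUps]
    rfl
  rw [hstep]
  exact Measurable.dite ((G.measurable_fireProb hG hE).comp
    (measurable_subtype_coe.prodMk π.measurable_app))
    ((measurable_one.indicator hE).comp measurable_subtype_coe) G.measurableSet_app_nonempty

end ChasePolicy

end Program

/-! ### Laws of time-homogeneous Markov processes -/

section Markov

variable {Ω : Type*} [MeasurableSpace Ω] {κ : Kernel Ω Ω} {μ₀ : Measure Ω}
  {P P' : Measure (ℕ → Ω)}

/-- `P` is the law, on the path space, of a Markov process with initial distribution `μ₀` and
transition kernel `κ`. -/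
def IsMarkovLaw (κ : Kernel Ω Ω) (μ₀ : Measure Ω) (P : Measure (ℕ → Ω)) : Prop :=
  P.map (fun ω => ω 0) = μ₀ ∧
  ∀ (n : ℕ) (A : Set (Fin (n + 1) → Ω)) (E : Set Ω), MeasurableSet A → MeasurableSet E →
    P {ω | (fun i : Fin (n + 1) => ω i) ∈ A ∧ ω (n + 1) ∈ E} =
      ∫⁻ ω in {ω | (fun i : Fin (n + 1) => ω i) ∈ A}, κ (ω n) E ∂P

/-- The first `n + 1` entries of a path. -/
def pathPrefix (n : ℕ) (ω : ℕ → Ω) : Fin (n + 1) → Ω := fun i => ω i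

lemma measurable_pathPrefix (n : ℕ) : Measurable (pathPrefix n : (ℕ → Ω) → _) :=
  measurable_pi_lambda _ fun _ => measurable_pi_apply _

lemma IsMarkovLaw.isFiniteMeasure [IsFiniteMeasure μ₀] (h : IsMarkovLaw κ μ₀ P) :
    IsFiniteMeasure P := by
  refine ⟨?_⟩
  rw [← preimage_univ (f := fun ω : ℕ → Ω => ω 0),
    ← Measure.map_apply (measurable_pi_apply 0) .univ, h.1]
  exact measure_lt_top μ₀ univ

lemma IsMarkovLaw.measure_univ (h : IsMarkovLaw κ μ₀ P) : P univ = μ₀ univ := by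
  rw [← h.1, Measure.map_apply (measurable_pi_apply 0) .univ, preimage_univ]

lemma IsMarkovLaw.map_prefix_prodMk [IsMarkovKernel κ] [IsFiniteMeasure μ₀]
    (h : IsMarkovLaw κ μ₀ P) (n : ℕ) :
    P.map (fun ω => (pathPrefix n ω, ω (n + 1))) =
      P.map (pathPrefix n) ⊗ₘ
        κ.comap (fun x : Fin (n + 1) → Ω => x (Fin.last n)) (measurable_pi_apply _) := by
  have := h.isFiniteMeasure
  refine Measure.ext_prod fun {A E} hA hE => ?_
  rw [Measure.map_apply ((measurable_pathPrefix n).prodMk (measurable_pi_apply _)) (hA.prod hE),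
    Measure.compProd_apply_prod hA hE,
    setLIntegral_map hA (Kernel.measurable_coe _ hE) (measurable_pathPrefix n)]
  exact h.2 n A E hA hE

lemma IsMarkovLaw.map_prefix_eq [IsMarkovKernel κ] [IsFiniteMeasure μ₀]
    (h : IsMarkovLaw κ μ₀ P) (h' : IsMarkovLaw κ μ₀ P') (n : ℕ) :
    P.map (pathPrefix n) = P'.map (pathPrefix n) := by
  induction n with
  | zero =>
    have hconst : Measurable fun x : Ω => (fun _ => x : Fin (0 + 1) → Ω) :=
      measurable_pi_lambda _ fun _ => measurable_id
    have heq : (pathPrefix 0 : (ℕ → Ω) → _) = (fun x _ => x) ∘ fun ω => ω 0 := by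
      funext ω i
      simp [pathPrefix]
    rw [heq, ← Measure.map_map hconst (measurable_pi_apply 0), h.1,
      ← Measure.map_map hconst (measurable_pi_apply 0), h'.1]
  | succ n ih =>
    have hsnoc : Measurable fun q : (Fin (n + 1) → Ω) × Ω =>
        (Fin.snoc q.1 q.2 : Fin (n + 1 + 1) → Ω) := by
      refine measurable_pi_lambda _ fun i => ?_
      refine Fin.lastCases ?_ (fun i => ?_) i
      · simpa using measurable_snd
      · simp only [Fin.snoc_castSucc]
        exact (measurable_pi_apply i).comp measurable_fst
    have heq : (pathPrefix (n + 1) : (ℕ → Ω) → _) =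
        (fun q : (Fin (n + 1) → Ω) × Ω => (Fin.snoc q.1 q.2 : Fin (n + 1 + 1) → Ω)) ∘
          fun ω => (pathPrefix n ω, ω (n + 1)) := by
      funext ω i
      refine Fin.lastCases ?_ (fun i => ?_) i <;> simp [pathPrefix]
    have hpair := (measurable_pathPrefix (Ω := Ω) n).prodMk (measurable_pi_apply (n + 1))
    rw [heq, ← Measure.map_map hsnoc hpair, ← Measure.map_map hsnoc hpair,
      h.map_prefix_prodMk, h'.map_prefix_prodMk, ih]

lemma IsMarkovLaw.unique [IsMarkovKernel κ] [IsFiniteMeasure μ₀]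
    (h : IsMarkovLaw κ μ₀ P) (h' : IsMarkovLaw κ μ₀ P') : P = P' := by
  have := h.isFiniteMeasure
  have hlim : IsProjectiveLimit P' fun I : Finset ℕ => P.map I.restrict := by
    intro I
    have hr : Measurable fun (x : Fin (I.sup id + 1) → Ω) (i : I) =>
        x ⟨i, Nat.lt_succ_of_le (Finset.le_sup (f := id) i.2)⟩ :=
      measurable_pi_lambda _ fun i => measurable_pi_apply _
    have heq : (I.restrict : (ℕ → Ω) → _) = (fun (x : Fin (I.sup id + 1) → Ω) (i : I) =>
        x ⟨i, Nat.lt_succ_of_le (Finset.le_sup (f := id) i.2)⟩) ∘ pathPrefix (I.sup id) := rfl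
    change P'.map I.restrict = P.map I.restrict
    rw [heq, ← Measure.map_map hr (measurable_pathPrefix _), h'.map_prefix_eq h,
      Measure.map_map hr (measurable_pathPrefix _)]
  exact IsProjectiveLimit.unique (P := fun I : Finset ℕ => P.map I.restrict) (fun I => rfl) hlim

/-- A Markov process moves almost surely along every measurable relation to whose sections the
transition kernel gives full measure. -/
lemma IsMarkovLaw.ae_forall_mem [IsMarkovKernel κ] [IsFiniteMeasure μ₀]
    (h : IsMarkovLaw κ μ₀ P) {V : Set (Ω × Ω)} (hV : MeasurableSet V)
    (hκ : ∀ x, κ x {y | (x, y) ∉ V} = 0) : ∀ᵐ ω ∂P, ∀ n, (ω n, ω (n + 1)) ∈ V := by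
  refine ae_all_iff.2 fun n => ?_
  have := h.isFiniteMeasure
  have hpair := (measurable_pathPrefix (Ω := Ω) n).prodMk (measurable_pi_apply (n + 1))
  have hlast : Measurable fun q : (Fin (n + 1) → Ω) × Ω => (q.1 (Fin.last n), q.2) :=
    ((measurable_pi_apply _).comp measurable_fst).prodMk measurable_snd
  have hmeas := hlast hV.compl
  rw [ae_iff]
  change P ((fun ω => (pathPrefix n ω, ω (n + 1))) ⁻¹'
    ((fun q : (Fin (n + 1) → Ω) × Ω => (q.1 (Fin.last n), q.2)) ⁻¹' Vᶜ)) = 0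
  rw [← Measure.map_apply hpair hmeas, h.map_prefix_prodMk, Measure.compProd_apply hmeas]
  refine (lintegral_congr fun x => ?_).trans lintegral_zero
  exact hκ _

/-- Existence, by the theorem of Ionescu-Tulcea. The initial measure need not be a probability
measure: the kernel of trajectories is composed with the distribution of the initial state. -/
lemma exists_isMarkovLaw (κ : Kernel Ω Ω) [IsMarkovKernel κ] (μ₀ : Measure Ω)
    [IsFiniteMeasure μ₀] : ∃ P, IsMarkovLaw κ μ₀ P := by
  let η (n : ℕ) : Kernel (∀ _ : Finset.Iic n, Ω) Ω :=
    κ.comap (fun x => x ⟨n, Finset.mem_Iic.2 le_rfl⟩) (measurable_pi_apply _)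
  have hη (n : ℕ) : IsMarkovKernel (η n) := inferInstance
  have hinit : Measurable fun (x : Ω) (_ : Finset.Iic 0) => x :=
    measurable_pi_lambda _ fun _ => measurable_id
  let ν : Measure (∀ _ : Finset.Iic 0, Ω) := μ₀.map fun x _ => x
  let P : Measure (ℕ → Ω) := (Kernel.traj (X := fun _ => Ω) η 0) ∘ₘ ν
  have hmap (n : ℕ) : P.map (Preorder.frestrictLe n) =
      Kernel.partialTraj (X := fun _ => Ω) η 0 n ∘ₘ ν := by
    rw [Measure.map_comp _ _ (Preorder.measurable_frestrictLe n), Kernel.traj_map_frestrictLe]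
  have hstep (n : ℕ) : P.map (fun ω => (Preorder.frestrictLe (π := fun _ => Ω) n ω, ω (n + 1))) =
      P.map (Preorder.frestrictLe n) ⊗ₘ η n := by
    rw [hmap, Measure.compProd_eq_comp_prod, Measure.comp_assoc,
      Measure.map_comp _ _ ((Preorder.measurable_frestrictLe n).prodMk (measurable_pi_apply _))]
    congr 1
    ext x₀ : 1
    rw [Kernel.comp_apply, ← Measure.compProd_eq_comp_prod,
      Kernel.map_apply _ ((Preorder.measurable_frestrictLe n).prodMk (measurable_pi_apply _)),
      Kernel.partialTraj_compProd_eq_map_traj (X := fun _ => Ω) n.zero_le]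
  refine ⟨P, ?_, fun n A E hA hE => ?_⟩
  · have heval : Measurable fun x : ∀ _ : Finset.Iic 0, Ω => x ⟨0, Finset.mem_Iic.2 le_rfl⟩ :=
      measurable_pi_apply _
    have h0 : P.map (Preorder.frestrictLe 0) = ν := by
      rw [hmap, Kernel.partialTraj_self, Measure.id_comp]
    calc P.map (fun ω => ω 0)
        = (P.map (Preorder.frestrictLe 0)).map fun x => x ⟨0, Finset.mem_Iic.2 le_rfl⟩ := by
          rw [Measure.map_map heval (Preorder.measurable_frestrictLe 0)]
          rfl
      _ = μ₀ := by
          rw [h0, Measure.map_map heval hinit]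
          exact Measure.map_id
  · have he : Measurable fun (x : ∀ _ : Finset.Iic n, Ω) (i : Fin (n + 1)) =>
        x ⟨i, Finset.mem_Iic.2 (Nat.le_of_lt_succ i.2)⟩ :=
      measurable_pi_lambda _ fun i => measurable_pi_apply _
    have hA' := he hA
    have h := congrArg (fun m => m (((fun (x : ∀ _ : Finset.Iic n, Ω) (i : Fin (n + 1)) =>
        x ⟨i, Finset.mem_Iic.2 (Nat.le_of_lt_succ i.2)⟩) ⁻¹' A) ×ˢ E)) (hstep n)
    beta_reduce at h
    rw [Measure.map_apply ((Preorder.measurable_frestrictLe n).prodMk (measurable_pi_apply _))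
      (hA'.prod hE), Measure.compProd_apply_prod hA' hE,
      setLIntegral_map hA' (Kernel.measurable_coe _ hE) (Preorder.measurable_frestrictLe n)] at h
    exact h

end Markov

/-! ### The limit map -/

section Limit

variable {Ω : Type v} {T : Set (ℕ → Ω)}

lemma limInst_eq_inl_iff {ω : ℕ → Ω} {x : Ω} :
    limInst T ω = Sum.inl x ↔ ω ∈ T ∧ ∃ i, (∀ j > i, ω j = ω i) ∧ ω i = x := by
  unfold limInst
  split_ifs with h
  · have hc := h.2.choose_spec
    constructor
    · rintro heq
      exact ⟨h.1, _, hc, Sum.inl_injective heq⟩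
    · rintro ⟨-, i, hi, rfl⟩
      congr 1
      rcases lt_trichotomy i h.2.choose with hlt | heq | hgt
      · exact hi _ hlt
      · exact congrArg ω heq.symm
      · exact (hc _ hgt).symm
  · refine iff_of_false (by simp) ?_
    rintro ⟨hT, i, hi, -⟩
    exact h ⟨hT, i, hi⟩

lemma limInst_eq_inr_iff {ω : ℕ → Ω} :
    limInst T ω = Sum.inr () ↔ ¬ (ω ∈ T ∧ IsTerminating ω) := by
  unfold limInst
  split_ifs with h <;> simp [h]

lemma measurable_limInst [MeasurableSpace Ω] [MeasurableEq Ω] (hT : MeasurableSet T) :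
    Measurable (limInst T) := by
  have hconst (i : ℕ) : MeasurableSet {ω : ℕ → Ω | ∀ j > i, ω j = ω i} := by
    simp only [ofPred_forall]
    exact .iInter fun j => .iInter fun _ =>
      measurableSet_eq_fun (measurable_pi_apply j) (measurable_pi_apply i)
  have hinl {E : Set Ω} (hE : MeasurableSet E) : MeasurableSet (limInst T ⁻¹' (Sum.inl '' E)) := by
    have h : limInst T ⁻¹' (Sum.inl '' E) =
        T ∩ ⋃ i, {ω | ∀ j > i, ω j = ω i} ∩ (fun ω : ℕ → Ω => ω i) ⁻¹' E := by
      ext ω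
      simp only [mem_preimage, mem_image, mem_inter_iff, mem_iUnion, mem_ofPred_eq]
      constructor
      · rintro ⟨x, hx, heq⟩
        obtain ⟨hω, i, hi, rfl⟩ := limInst_eq_inl_iff.1 heq.symm
        exact ⟨hω, i, hi, hx⟩
      · rintro ⟨hω, i, hi, hx⟩
        exact ⟨ω i, hx, (limInst_eq_inl_iff.2 ⟨hω, i, hi, rfl⟩).symm⟩
    rw [h]
    exact hT.inter (.iUnion fun i => (hconst i).inter (measurable_pi_apply i hE))
  intro s hs
  have hinr : limInst T ⁻¹' (Sum.inr '' univ) = (limInst T ⁻¹' (Sum.inl '' univ))ᶜ := by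
    rw [← preimage_compl, image_univ, image_univ, compl_range_inl]
  rw [← image_preimage_inl_union_image_preimage_inr s, preimage_union]
  refine (hinl (measurable_inl hs)).union ?_
  rcases (Sum.inr ⁻¹' s : Set Unit).eq_empty_or_nonempty with h | h
  · simp [h]
  · rw [h.eq_univ, hinr]
    exact (hinl .univ).compl

end Limit

namespace Program.ChasePolicy

variable {S : Type u} {σ : Schema S} {dom : S → Type v} [∀ s, MeasurableSpace (dom s)]
  {G : Program σ dom} (π : G.ChasePolicy)

lemma stepP_not_stepE (D : G.DD) : π.stepP D {D' | ¬ π.StepE D D'} = 0 := by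
  unfold stepP StepE
  split_ifs with h
  · have hempty : {D' | D' ∉ G.followUps D (π.app ⟨D, h⟩)} ∩ G.followUps D (π.app ⟨D, h⟩) = ∅ :=
      compl_inter_self _
    simp [hempty, fireProb]
  · simp

variable [∀ s, StandardBorelSpace (dom s)] [∀ s, Nonempty (dom s)]

open Classical in
/-- The distribution of the next instance of the chase. -/
noncomputable def stepMeasure (D : G.DD) : Measure G.DD :=
  if h : (G.App D).Nonempty then G.fireMeasure D (π.app ⟨D, h⟩) else Measure.dirac D

lemma stepMeasure_apply (D : G.DD) {E : Set G.DD} (hE : MeasurableSet E) :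
    π.stepMeasure D E = π.stepP D E := by
  unfold stepMeasure stepP
  split_ifs with h
  · rw [G.fireMeasure_apply _ _ hE, G.fireProb_inter_followUps]
  · exact Measure.dirac_apply' D hE

/-- The transition kernel of the chase. -/
noncomputable def stepKernel (hG : ∀ j, (G.prob j).dist.IsRegular) : Kernel G.DD G.DD where
  toFun := π.stepMeasure
  measurable' := Measure.measurable_of_measurable_coe _ fun E hE => by
    simpa only [π.stepMeasure_apply _ hE] using π.measurable_stepP hG hE

variable (hG : ∀ j, (G.prob j).dist.IsRegular)

lemma stepKernel_apply (D : G.DD) {E : Set G.DD} (hE : MeasurableSet E) :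
    π.stepKernel hG D E = π.stepP D E :=
  π.stepMeasure_apply D hE

instance instIsMarkovKernelStepKernel : IsMarkovKernel (π.stepKernel hG) := by
  refine ⟨fun D => ?_⟩
  change IsProbabilityMeasure (π.stepMeasure D)
  unfold stepMeasure
  split_ifs <;> infer_instance

lemma isChaseLaw_iff {μ₀ : Measure G.DD} {P : Measure (ℕ → G.DD)} :
    π.IsChaseLaw μ₀ P ↔ IsMarkovLaw (π.stepKernel hG) μ₀ P := by
  refine and_congr_right fun _ => ?_
  refine forall₃_congr fun n A E => forall₂_congr fun _ hE => ?_
  simp only [π.stepKernel_apply hG _ hE]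

/-! ### Paths and output of the chase -/

lemma measurableSet_stepE : MeasurableSet {q : G.DD × G.DD | π.StepE q.1 q.2} := by
  classical
  have hT : MeasurableSet {q : G.DD × G.DD | (G.App q.1).Nonempty} :=
    measurable_fst G.measurableSet_app_nonempty
  have happ : Measurable fun q : {q : G.DD × G.DD | (G.App q.1).Nonempty} =>
      (q.1, π.app ⟨q.1.1, q.2⟩) :=
    measurable_subtype_coe.prodMk (π.measurable_app.comp
      (measurable_fst.comp measurable_subtype_coe).subtype_mk)
  have h : {q : G.DD × G.DD | π.StepE q.1 q.2} =
      Subtype.val '' ((fun q : {q : G.DD × G.DD | (G.App q.1).Nonempty} =>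
        (q.1, π.app ⟨q.1.1, q.2⟩)) ⁻¹' {q | q.1.2 ∈ G.followUps q.1.1 q.2}) ∪
      ({q | (G.App q.1).Nonempty}ᶜ ∩ {q | q.2 = q.1}) := by
    ext q
    by_cases hq : (G.App q.1).Nonempty <;> simp [StepE, hq]
  rw [h]
  exact (hT.subtype_image (happ G.measurableSet_followUps)).union
    (hT.compl.inter (measurableSet_eq_fun measurable_snd measurable_fst))

lemma measurableSet_paths : MeasurableSet π.paths := by
  simp only [paths, ofPred_forall]
  refine .iInter fun i => ?_
  have hpair : Measurable fun ω : ℕ → G.DD => (ω i, ω (i + 1)) :=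
    (measurable_pi_apply i).prodMk (measurable_pi_apply (i + 1))
  exact hpair π.measurableSet_stepE

lemma measurableSet_pathsFrom (D : G.DD) : MeasurableSet (π.pathsFrom D) :=
  π.measurableSet_paths.inter
    (measurableSet_eq_fun (f := fun ω : ℕ → G.DD => ω 0) (measurable_pi_apply 0) measurable_const)

lemma ae_mem_paths {μ₀ : Measure G.DD} [IsFiniteMeasure μ₀] {P : Measure (ℕ → G.DD)}
    (hP : IsMarkovLaw (π.stepKernel hG) μ₀ P) : ∀ᵐ ω ∂P, ω ∈ π.paths := by
  refine hP.ae_forall_mem π.measurableSet_stepE fun D => ?_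
  exact (π.stepKernel_apply hG D (measurable_prodMk_left π.measurableSet_stepE.compl)).trans
    (π.stepP_not_stepE D)

/-- The chase defines an output for every measurable set of paths that carries the chase law. -/
lemma definesOutput {μ₀ : Measure G.DD} (hμ₀ : μ₀ univ ≤ 1) {T : Set (ℕ → G.DD)}
    (hT : MeasurableSet T)
    (hae : ∀ P, IsMarkovLaw (π.stepKernel hG) μ₀ P → ∀ᵐ ω ∂P, ω ∈ T) :
    π.DefinesOutput μ₀ (limInst T) := by
  have : IsFiniteMeasure μ₀ := ⟨hμ₀.trans_lt ENNReal.one_lt_top⟩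
  have hlim := measurable_limInst hT
  have hinl : MeasurableEmbedding (Sum.inl : G.DD → G.DD ⊕ Unit) :=
    ⟨Sum.inl_injective, measurable_inl, fun _ => measurableSet_inl_image.2⟩
  obtain ⟨P, hP⟩ := exists_isMarkovLaw (π.stepKernel hG) μ₀
  refine ⟨hlim, P, (π.isChaseLaw_iff hG).2 hP,
    fun P' hP' => ((π.isChaseLaw_iff hG).1 hP').unique hP, hP.measure_univ, ?_, ?_⟩
  · rw [Measure.map_apply hlim]
    · refine measure_congr ?_
      filter_upwards [hae P hP] with ω hω
      refine propext ?_
      change limInst T ω = Sum.inr () ↔ ¬ IsTerminating ω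
      simp [limInst_eq_inr_iff, hω]
    · rw [← image_singleton]
      exact measurableSet_inr_image.2 (measurableSet_singleton ())
  · refine ⟨⟨(P.map (limInst T)).comap Sum.inl, ?_⟩, fun E _ => ?_, fun Δ hΔ => ?_⟩
    · rw [hinl.comap_apply]
      refine (measure_mono (subset_univ _)).trans ?_
      rw [Measure.map_apply hlim .univ, preimage_univ, hP.measure_univ]
      exact hμ₀
    · exact hinl.comap_apply _ _
    · refine Subtype.ext (Measure.ext fun E hE => ?_)
      rw [hΔ E hE]
      exact (hinl.comap_apply _ _).symm

end Program.ChasePolicy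

end GDatalog

theorem mainTheorem3 {S : Type*} {dom : S → Type*}
    [∀ s, MeasurableSpace (dom s)] [∀ s, StandardBorelSpace (dom s)] [∀ s, Nonempty (dom s)]
    (σ : GDatalog.Schema S) (G : GDatalog.Program σ dom)
    (hG : ∀ j, (G.prob j).dist.IsRegular) (π : G.ChasePolicy) :
    (∃ κ : Kernel G.DD G.DD, IsMarkovKernel κ ∧
      ∀ D E, MeasurableSet E → κ D E = π.stepP D E) ∧
    (∀ D ∈ G.inputs,
      π.DefinesOutput (Measure.dirac D) (GDatalog.limInst (π.pathsFrom D))) ∧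
    (∀ Q : GDatalog.SubPDB G.inputs,
      π.DefinesOutput (Q.1.map Subtype.val) (GDatalog.limInst π.paths)) := by
  refine ⟨⟨π.stepKernel hG, inferInstance, fun D E hE => π.stepKernel_apply hG D hE⟩,
    fun D _ => ?_, fun Q => ?_⟩
  · refine π.definesOutput hG (by simp) (π.measurableSet_pathsFrom D) fun P hP => ?_
    have h0 : ∀ᵐ ω ∂P, ω 0 = D := by
      refine ae_of_ae_map (f := fun ω : ℕ → G.DD => ω 0)
        (measurable_pi_apply 0).aemeasurable (p := fun x => x = D) ?_
      rw [hP.1, ae_dirac_eq]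
      rfl
    filter_upwards [π.ae_mem_paths hG hP, h0] with ω h₁ h₂ using ⟨h₁, h₂⟩
  · have hQ : Q.1.map Subtype.val univ ≤ 1 := by
      rw [Measure.map_apply measurable_subtype_coe .univ, preimage_univ]
      exact Q.2
    have : IsFiniteMeasure (Q.1.map Subtype.val) := ⟨hQ.trans_lt ENNReal.one_lt_top⟩
    exact π.definesOutput hG hQ π.measurableSet_paths fun P hP => π.ae_mem_paths hG hP
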